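/- Let $F_1(t)=\sqrt{t/(2\pi)}\,(\cos t,\sin t)$ be the polar square-root spiral in $\mathbb R^2$, let $C=\{F_1(s): s\ge 2\pi\}$, and let $F_0(t)=F_1(t)+F_1'(t)/\|F_1'(t)\|$ be its front track. Let $E_1(t)$, the unibike error at $t$, be the distance from $F_0(t)$ to the closest point of $C$. Put $R_1(t)=\|F_1(t)\|$ and $R_0(t)=\|F_0(t)\|$, and let $\alpha(t)=t+2\pi+\beta(t)$, where $\beta(t)\in[0,2\pi)$ is the number for which $t+\beta(t)$ is a polar angle of $F_0(t)$. Let $$\lambda(t)=\frac{\pi}{3}t^{-2}+\frac{1}{2\sqrt2}\pi^{1/2}t^{-5/2}-\frac{11}{15}\pi^2t^{-3}-\frac{11}{6\sqrt2}\pi^{3/2}t^{-7/2}.$$ All asymptotic statements are for $t\to\infty$. (a) For all $t\ge 2\pi$, $E_1(t)\le R_0(t)-R_1(\alpha(t))$, and $R_0(t)-R_1(\alpha(t))$ is the distance from $F_0(t)$ to $F_1(\alpha(t))$. Moreover $$R_0(t)-R_1(\alpha(t))=\lambda(t)+\left(\frac{103}{70}\pi^2-\frac58\right)\pi\,t^{-4}+O(t^{-9/2}),$$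 where the coefficient of $t^{-4}$ is about $43.66$ (to within $0.005$). (b) Let $d(t)$ be the shortest distance from $F_0(t)$ to the tangent line of $F_1$ at parameter $\alpha(t)$, i.e. the line through $F_1(\alpha(t))$ and $F_1(\alpha(t))+F_1'(\alpha(t))$. Then $E_1(t)\ge d(t)$ for all sufficiently large $t$, and $$d(t)=\lambda(t)+\left(\frac{103}{70}\pi^2-\frac23\right)\pi\,t^{-4}+O(t^{-9/2}),$$ where the coefficient of $t^{-4}$ is about $43.53$ (to within $0.005$). (c) $$E_1(t)=\frac{\pi}{3}t^{-2}+\frac{1}{2\sqrt2}\pi^{1/2}t^{-5/2}-\frac{11}{15}\pi^2t^{-3}-\frac{11}{6\sqrt2}\pi^{3/2}t^{-7/2}+O(t^{-4}).$$ -/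

import Mathlib

open Real Filter Asymptotics Metric

noncomputable section

/-- The Euclidean plane. -/
abbrev Plane : Type := EuclideanSpace ℝ (Fin 2)

/-- The front track of `f` at `t`: the end of the unit tangent vector to `f` at `f t`. -/
def frontTrack (f : ℝ → Plane) (t : ℝ) : Plane :=
  f t + (‖deriv f t‖)⁻¹ • deriv f t

/-- The unibike error at `t` of the curve parametrized by `f` on the parameter set `I`:
the shortest distance from the front point at `t` to the curve. -/
def unibikeError (f : ℝ → Plane) (I : Set ℝ) (t : ℝ) : ℝ :=
  infDist (frontTrack f t) (f '' I)

/-- The polar square root spiral. -/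
def F₁ (t : ℝ) : Plane := √(t / (2 * π)) • !₂[cos t, sin t]

/-- The front track of the polar square root spiral. -/
def F₀ (t : ℝ) : Plane := frontTrack F₁ t

/-- The unibike error of the polar square root spiral, which starts at `t = 2π`. -/
def E₁ (t : ℝ) : ℝ := unibikeError F₁ (Set.Ici (2 * π)) t

/-- The polar radius of the spiral. -/
def R₁ (t : ℝ) : ℝ := ‖F₁ t‖

/-- The polar radius of the front track. -/
def R₀ (t : ℝ) : ℝ := ‖F₀ t‖

/-- The angle in `[0, 2π)` from the ray through `F₁ t` to the ray through `F₀ t`, measured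
counterclockwise (`F₁ t` has polar angle `t`). -/
def β (t : ℝ) : ℝ := toIcoMod two_pi_pos 0 (Complex.arg ⟨F₀ t 0, F₀ t 1⟩ - t)

/-- The angular parameter for the front point: the polar angle of `F₀ t` lying in
`[t + 2π, t + 4π)`. -/
def α (t : ℝ) : ℝ := t + 2 * π + β t

/-- The shortest distance from the point `Z` to the line through `X` and `Y`. -/
def lineDist (X Y Z : Plane) : ℝ := infDist Z (line[ℝ, X, Y] : Set Plane)

/-- The expansion up to `t ^ (-7/2)` that both error bounds share. -/
def errorModel (t : ℝ) : ℝ :=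
  π / 3 * t ^ (-2 : ℝ) + 1 / (2 * √2) * π ^ (1 / 2 : ℝ) * t ^ (-(5 / 2) : ℝ)
    - 11 / 15 * π ^ 2 * t ^ (-3 : ℝ)
    - 11 / (6 * √2) * π ^ (3 / 2 : ℝ) * t ^ (-(7 / 2) : ℝ)

/-- `α t` is a polar angle of `F₀ t`. -/
theorem F₀_eq_polar (t : ℝ) : F₀ t = R₀ t • !₂[cos (α t), sin (α t)] := by
  have h : toIcoMod two_pi_pos 0 (Complex.arg ⟨F₀ t 0, F₀ t 1⟩ - t) = (Complex.arg ⟨F₀ t 0, F₀ t 1⟩ - t) - toIcoDiv two_pi_pos 0 (Complex.arg ⟨F₀ t 0, F₀ t 1⟩ - t) * (2*π) := by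
    rw [toIcoMod]; simp
  have h2 : α t = Complex.arg ⟨F₀ t 0, F₀ t 1⟩ - ((toIcoDiv two_pi_pos 0 (Complex.arg ⟨F₀ t 0, F₀ t 1⟩ - t) - 1 : ℤ):ℝ) * (2*π) := by
    rw [α, β, h]; push_cast; ring
  have hn : R₀ t = ‖(⟨F₀ t 0, F₀ t 1⟩ : ℂ)‖ := by
    rw [R₀, EuclideanSpace.norm_eq, Complex.norm_eq_sqrt_sq_add_sq]; simp
  rw [h2, cos_sub_int_mul_two_pi, sin_sub_int_mul_two_pi, hn]
  ext i; fin_cases i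
  · simp [Complex.norm_mul_cos_arg]
  · simp [Complex.norm_mul_sin_arg]

theorem continuous_F₁ : Continuous F₁ := by
  unfold F₁
  refine Continuous.smul (f := fun t : ℝ => √(t/(2*π))) (by fun_prop) ?_
  refine (PiLp.continuous_toLp 2 _).comp ?_
  refine continuous_pi fun i => by fin_cases i <;> simp <;> fun_prop

theorem norm_F₁ (t : ℝ) : ‖F₁ t‖ = √(t / (2 * π)) := by
  simp [F₁, norm_smul, EuclideanSpace.norm_eq]

/-- There is a closest point of the spiral to `F₀ t`, and `E₁ t` is its distance from `F₀ t`. -/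
theorem exists_closest_point (t : ℝ) : ∃ s, 2 * π ≤ s ∧ E₁ t = dist (F₀ t) (F₁ s) ∧
    ∀ u, 2 * π ≤ u → dist (F₀ t) (F₁ s) ≤ dist (F₀ t) (F₁ u) := by
  obtain ⟨s, hs, hm⟩ : ∃ s ∈ Set.Ici (2 * π), IsMinOn (fun s => dist (F₀ t) (F₁ s)) (Set.Ici (2*π)) s := by
    refine ContinuousOn.exists_isMinOn' (by have := continuous_F₁; fun_prop) isClosed_Ici (x₀ := 2*π) (by simp) ?_
    have : Tendsto (fun s => dist (F₀ t) (F₁ s)) atTop atTop := by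
      have h1 : Tendsto (fun s => √(s / (2 * π)) - ‖F₀ t‖) atTop atTop := by
        apply tendsto_atTop_add_const_right
        exact Real.tendsto_sqrt_atTop.comp (tendsto_id.atTop_div_const two_pi_pos)
      refine tendsto_atTop_mono (fun s => ?_) h1
      rw [← norm_F₁, dist_comm, dist_eq_norm]; exact norm_sub_norm_le _ _
    have h3 := this.eventually_ge_atTop (dist (F₀ t) (F₁ (2*π)))
    rw [Filter.eventually_inf_principal]
    have : ∀ᶠ s in cocompact ℝ, s ∈ Set.Ici (2*π) → dist (F₀ t) (F₁ (2*π)) ≤ dist (F₀ t) (F₁ s) := by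
      rw [cocompact_eq_atBot_atTop, eventually_sup]
      refine ⟨?_, h3.mono fun _ h _ => h⟩
      filter_upwards [eventually_lt_atBot (2*π)] with s hs h
      exact absurd hs (not_lt.2 h)
    exact this
  refine ⟨s, hs, ?_, fun u hu => hm hu⟩
  apply le_antisymm
  · exact infDist_le_dist_of_mem (Set.mem_image_of_mem F₁ hs)
  · refine (le_infDist (Set.nonempty_Ici.image F₁)).2 ?_
    rintro _ ⟨u, hu, rfl⟩; exact hm hu

end

/-! Put `u = t^(-1/2)`, `c = √(2π)`, `w = invSpeed u`. In the radial/tangential frame at angle `t`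
the front point has coordinates `(r + w/(2t), w)` with `r = 1/(c u)`, so its angle and radius are
explicit. Squared radii make the gap tractable: a full turn adds exactly 1 to `R₁ ^ 2`, as does the
unit tangent to `R₀ ^ 2`. What remains of `R₀ ^ 2 - R₁ (α t) ^ 2` is `(c u w - β) / c ^ 2`, and
division by the sum of the radii gives `radialGap` (`R₀_sub_R₁`). Its Taylor expansion at `u = 0`
(`radialGap_expansion`) yields (a).

The tangent at `α t` is slightly tilted from the perpendicular to the radius, so its distance to the
front point is the gap times the cosine of the tilt (`lineDist_eq`). That cosine is `1 - t ^ (-2) /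
8 + O(t ^ (-3))`; against the leading term `π/3 * t ^ (-2)` it costs `π/24 * t ^ (-4)`, which turns
5/8 into 2/3. The lower bound `lineDist_le_E₁` locates the closest point of the spiral: before `α t`
the radius is too small, after half a turn too large, and in between the spiral lies on the inner
side of the tangent (`R₁_mul_le`). Sandwiching `E₁` gives (c). -/

/-! ### Taylor polynomials with explicit remainders. -/

theorem abs_sqrt_one_add_sub_le {x : ℝ} (hx : |x| ≤ 1) :
    |√(1 + x) - (1 + x / 2 - x ^ 2 / 8)| ≤ |x| ^ 3 := by
  obtain ⟨h1, h2⟩ := abs_le.1 hx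
  have hs := Real.sq_sqrt (show 0 ≤ 1 + x by linarith)
  have hs0 := Real.sqrt_nonneg (1 + x)
  set s := √(1 + x)
  have hx2 : x ^ 2 ≤ 1 := by nlinarith
  have hp : 3 / 8 ≤ 1 + x / 2 - x ^ 2 / 8 := by linarith
  -- A difference of squares: the second factor is at least 3/8 and `1/8 - x/64 ≤ 9/64`, so the
  -- constant 3/8 ≤ 1 results.
  have key : (s - (1 + x / 2 - x ^ 2 / 8)) * (s + (1 + x / 2 - x ^ 2 / 8))
      = x ^ 3 * (1 / 8 - x / 64) := by linear_combination hs
  have hk := congrArg abs key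
  rw [abs_mul, abs_mul, abs_pow, abs_of_pos (show 0 < s + (1 + x / 2 - x ^ 2 / 8) by linarith),
    abs_of_pos (show 0 < 1 / 8 - x / 64 by linarith)] at hk
  have h3 : 0 ≤ |x| ^ 3 := by positivity
  nlinarith [abs_nonneg (s - (1 + x / 2 - x ^ 2 / 8)), mul_nonneg h3 (show 0 ≤ 1 + x by linarith),
    mul_nonneg (abs_nonneg (s - (1 + x / 2 - x ^ 2 / 8)))
      (show 0 ≤ s + (1 + x / 2 - x ^ 2 / 8) - 3 / 8 by linarith)]

theorem abs_inv_sqrt_one_add_sub_le {v : ℝ} (hv : 0 ≤ v) :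
    |(√(1 + v))⁻¹ - (1 - v / 2)| ≤ v ^ 2 := by
  have hs := Real.sq_sqrt (show 0 ≤ 1 + v by linarith)
  have hs1 : 1 ≤ √(1 + v) := Real.one_le_sqrt.2 (by linarith)
  set s := √(1 + v)
  have hv' : v = s ^ 2 - 1 := by linarith
  have hs0 : 0 < s := by linarith
  have h : s⁻¹ - (1 - v / 2) = (s - 1) ^ 2 * (s + 2) / (2 * s) := by
    rw [hv']; field_simp; ring
  rw [h, abs_of_nonneg (by positivity), div_le_iff₀ (by positivity), hv']
  have : (s ^ 2 - 1) ^ 2 * (2 * s) = (s - 1) ^ 2 * (2 * s * (s + 1) ^ 2) := by ring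
  rw [this]
  gcongr
  nlinarith

theorem abs_inv_one_add_sub_le {z : ℝ} (hz : |z| ≤ 1 / 2) :
    |(1 + z)⁻¹ - (1 - z + z ^ 2)| ≤ 2 * |z| ^ 3 := by
  obtain ⟨h1, h2⟩ := abs_le.1 hz
  have h0 : 0 < 1 + z := by linarith
  have h : (1 + z)⁻¹ - (1 - z + z ^ 2) = -z ^ 3 * (1 + z)⁻¹ := by field_simp; ring
  rw [h, abs_mul, abs_neg, abs_pow, abs_of_pos (inv_pos.2 h0), mul_comm]
  gcongr
  rw [inv_le_comm₀ h0 two_pos]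
  linarith

/-- The remainder has derivative `x ^ 8 / (1 + x ^ 2)`, at most `|y| ^ 8` between `-|y|` and `|y|`;
the mean value inequality from 0 finishes. -/
theorem abs_arctan_sub_le (y : ℝ) :
    |arctan y - (y - y ^ 3 / 3 + y ^ 5 / 5 - y ^ 7 / 7)| ≤ |y| ^ 9 := by
  have hd : ∀ x : ℝ, HasDerivAt (fun x => arctan x - (x - x ^ 3 / 3 + x ^ 5 / 5 - x ^ 7 / 7))
      (x ^ 8 / (1 + x ^ 2)) x := by
    intro x
    have h := (hasDerivAt_arctan x).sub ((((hasDerivAt_id x).sub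
      ((hasDerivAt_pow 3 x).div_const 3)).add ((hasDerivAt_pow 5 x).div_const 5)).sub
      ((hasDerivAt_pow 7 x).div_const 7))
    refine h.congr_deriv ?_
    have : 0 < 1 + x ^ 2 := by positivity
    field_simp
    push_cast
    ring
  have := (convex_Icc (-|y|) |y|).norm_image_sub_le_of_norm_hasDerivWithin_le (C := |y| ^ 8)
    (fun x _ => (hd x).hasDerivWithinAt) (fun x hx => ?_) (x := 0) (y := y)
    (by simp) ⟨neg_abs_le y, le_abs_self y⟩
  · simp only [Real.norm_eq_abs] at this
    simpa [pow_succ] using this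
  · have hx' : |x| ≤ |y| := abs_le.2 hx
    rw [Real.norm_eq_abs, abs_div, abs_pow, abs_of_pos (show 0 < 1 + x ^ 2 by positivity)]
    refine (div_le_self (by positivity) (by nlinarith [sq_nonneg x])).trans ?_
    gcongr

/-! ### Calculus of `O(u ^ n)` at 0. -/

theorem isBigO_pow_mul {g : ℝ → ℝ} (hg : Continuous g) (n : ℕ) :
    (fun u => u ^ n * g u) =O[nhds 0] fun u : ℝ => u ^ n := by
  simpa using (isBigO_refl (fun u : ℝ => u ^ n) (nhds 0)).mul (hg.continuousAt.isBigO_one ℝ)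

theorem isBigO_pow_of_eq {f g : ℝ → ℝ} (n : ℕ) (hg : Continuous g) (h : ∀ u, f u = u ^ n * g u) :
    f =O[nhds 0] fun u : ℝ => u ^ n :=
  (isBigO_pow_mul hg n).congr_left fun u => (h u).symm

theorem isBigO_pow_pow {m n : ℕ} (h : m ≤ n) :
    (fun u : ℝ => u ^ n) =O[nhds 0] fun u : ℝ => u ^ m :=
  isBigO_pow_of_eq (g := fun u => u ^ (n - m)) m (by fun_prop) fun u => by
    rw [← pow_add]; congr 1; omega

theorem Asymptotics.IsBigO.mul_sub_mul {f g f' g' : ℝ → ℝ} {n : ℕ} {l : Filter ℝ}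
    (h : (fun u => f u - g u) =O[l] fun u => u ^ n)
    (h' : (fun u => f' u - g' u) =O[l] fun u => u ^ n)
    (hf' : f' =O[l] (1 : ℝ → ℝ)) (hg : g =O[l] (1 : ℝ → ℝ)) :
    (fun u => f u * f' u - g u * g' u) =O[l] fun u => u ^ n := by
  have h1 := h.mul hf'
  have h2 := hg.mul h'
  simp only [Pi.one_apply, mul_one, one_mul] at h1 h2
  exact (h1.add h2).congr_left fun u => by ring

theorem Asymptotics.IsBigO.pow_sub_pow {f g : ℝ → ℝ} {n : ℕ} {l : Filter ℝ}
    (h : (fun u => f u - g u) =O[l] fun u => u ^ n)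
    (hf : f =O[l] (1 : ℝ → ℝ)) (hg : g =O[l] (1 : ℝ → ℝ)) (k : ℕ) :
    (fun u => f u ^ k - g u ^ k) =O[l] fun u => u ^ n := by
  induction k with
  | zero => simpa using isBigO_zero (fun u : ℝ => u ^ n) l
  | succ k ih =>
    simp only [pow_succ]
    have : (fun u => g u ^ k) =O[l] (1 : ℝ → ℝ) := by simpa [Pi.one_def] using hg.pow k
    exact ih.mul_sub_mul h hf this

/-! ### Expansion of the radial gap in `u = t^(-1/2)`. -/

noncomputable section

/-- The ratio of the radius to the speed of the spiral at the parameter `u⁻²`. -/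
def invSpeed (u : ℝ) : ℝ := (√(1 + u ^ 4 / 4))⁻¹

/-- The tangent of the angle between the front and rear points at the parameter `u⁻²`. -/
def frontTan (c u : ℝ) : ℝ := c * u * (invSpeed u * (1 + c * u ^ 3 * invSpeed u / 2)⁻¹)

/-- The angle between the front and rear points at the parameter `u⁻²`. -/
def frontAngle (c u : ℝ) : ℝ := arctan (frontTan c u)

/-- The sum of the radii of the front point and of the spiral in its direction,
rescaled by `c * u`. -/
def radiusSum (c u : ℝ) : ℝ :=
  √(1 + (c ^ 2 * u ^ 2 + c * u ^ 3 * invSpeed u)) + √(1 + (c ^ 2 * u ^ 2 + u ^ 2 * frontAngle c u))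

/-- The radial gap between the front point and the spiral at the parameter `u⁻²`. -/
def radialGap (c u : ℝ) : ℝ :=
  u / c * (c * u * invSpeed u - frontAngle c u) / radiusSum c u

theorem invSpeed_expansion :
    (fun u => invSpeed u - (1 - u ^ 4 / 8)) =O[nhds 0] fun u : ℝ => u ^ 8 := by
  refine IsBigO.of_bound 1 (Eventually.of_forall fun u => ?_)
  have h := abs_inv_sqrt_one_add_sub_le (v := u ^ 4 / 4) (by positivity)
  rw [Real.norm_eq_abs, norm_pow, Real.norm_eq_abs, one_mul, invSpeed]
  have h8 : |u| ^ 8 = u ^ 8 := Even.pow_abs (by decide) u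
  rw [h8]
  have e : u ^ 4 / 4 / 2 = u ^ 4 / 8 := by ring
  rw [e] at h
  have : 0 ≤ u ^ 8 := by positivity
  have e2 : (u ^ 4 / 4) ^ 2 = u ^ 8 / 16 := by ring
  linarith

theorem continuous_invSpeed : Continuous invSpeed := by
  unfold invSpeed
  refine Continuous.inv₀ (by fun_prop) fun u => ?_
  have : 0 < 1 + u ^ 4 / 4 := by positivity
  positivity

theorem Continuous.isBigO_one_zero {f : ℝ → ℝ} (hf : Continuous f) :
    f =O[nhds 0] (1 : ℝ → ℝ) := hf.continuousAt.isBigO_one ℝ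

theorem isBigO_pow_one (n : ℕ) : (fun u : ℝ => u ^ n) =O[nhds 0] (1 : ℝ → ℝ) :=
  Continuous.isBigO_one_zero (by fun_prop)

theorem inv_one_add_expansion (c : ℝ) :
    (fun u => (1 + c * u ^ 3 * invSpeed u / 2)⁻¹ - (1 - c * u ^ 3 / 2 + c ^ 2 * u ^ 6 / 4))
      =O[nhds 0] fun u : ℝ => u ^ 7 := by
  set z : ℝ → ℝ := fun u => c * u ^ 3 * invSpeed u / 2 with hz
  have hzc : Continuous z := by have := continuous_invSpeed; fun_prop
  have hz3 : z =O[nhds 0] fun u : ℝ => u ^ 3 :=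
    isBigO_pow_of_eq (g := fun u => c / 2 * invSpeed u) 3
      (by have := continuous_invSpeed; fun_prop) fun u => by simp only [hz]; ring
  have hsmall : ∀ᶠ u in nhds 0, |z u| ≤ 1 / 2 := by
    have : Tendsto (fun u => |z u|) (nhds 0) (nhds |z 0|) := hzc.abs.tendsto 0
    have h0 : |z 0| < 1 / 2 := by simp [hz]
    exact (this.eventually_lt_const h0).mono fun u hu => hu.le
  have h1 : (fun u => (1 + z u)⁻¹ - (1 - z u + z u ^ 2)) =O[nhds 0] fun u : ℝ => u ^ 7 := by
    refine (IsBigO.trans (IsBigO.of_bound 2 ?_) ((hz3.pow 3).congr_right fun u => ?_)).trans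
      (isBigO_pow_pow (n := 9) (by norm_num))
    · filter_upwards [hsmall] with u hu
      simpa using abs_inv_one_add_sub_le hu
    · ring
  have h2 : (fun u => z u - c * u ^ 3 / 2) =O[nhds 0] fun u : ℝ => u ^ 7 := by
    have := (isBigO_refl (fun u : ℝ => c / 2 * u ^ 3) (nhds 0)).mul invSpeed_expansion
    have h3 : (fun u => z u - c * u ^ 3 / 2 * (1 - u ^ 4 / 8)) =O[nhds 0] fun u : ℝ => u ^ 7 :=
      (this.trans (isBigO_pow_of_eq (g := fun u => c / 2 * u ^ 4) 7 (by fun_prop)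
        fun u => by ring)).congr_left fun u => by simp only [hz]; ring
    exact (h3.sub (isBigO_pow_of_eq (f := fun u => c / 16 * u ^ 7) (g := fun u => c / 16) 7
      (by fun_prop) fun u => by ring)).congr_left fun u => by ring
  have h4 := h2.pow_sub_pow hzc.isBigO_one_zero (Continuous.isBigO_one_zero (by fun_prop)) 2
  exact ((h1.sub h2).add h4).congr_left fun u => by ring

theorem frontTan_expansion (c : ℝ) :
    (fun u => frontTan c u -
      (c * u - 1 / 2 * c ^ 2 * u ^ 4 - 1 / 8 * c * u ^ 5 + 1 / 4 * c ^ 3 * u ^ 7))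
      =O[nhds 0] fun u : ℝ => u ^ 8 := by
  have hI := inv_one_add_expansion c
  have hI1 : (fun u => (1 + c * u ^ 3 * invSpeed u / 2)⁻¹) =O[nhds 0] (1 : ℝ → ℝ) := by
    have h1 := hI.trans (isBigO_pow_one 7)
    have h2 : (fun u : ℝ => 1 - c * u ^ 3 / 2 + c ^ 2 * u ^ 6 / 4) =O[nhds 0] (1 : ℝ → ℝ) :=
      Continuous.isBigO_one_zero (by fun_prop)
    exact (h1.add h2).congr_left fun u => by ring
  have h := (invSpeed_expansion.trans (isBigO_pow_pow (by norm_num : 7 ≤ 8))).mul_sub_mul hI hI1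
    (Continuous.isBigO_one_zero (by fun_prop))
  have h1 := (isBigO_pow_of_eq (f := fun u => c * u) (g := fun _ => c) 1 (by fun_prop)
    fun u => by ring).mul h
  have h2 : (fun u : ℝ => c * u * ((1 - u ^ 4 / 8) * (1 - c * u ^ 3 / 2 + c ^ 2 * u ^ 6 / 4)) -
      (c * u - 1 / 2 * c ^ 2 * u ^ 4 - 1 / 8 * c * u ^ 5 + 1 / 4 * c ^ 3 * u ^ 7))
      =O[nhds 0] fun u : ℝ => u ^ 8 :=
    isBigO_pow_of_eq (g := fun u => 1 / 16 * c ^ 2 - 1 / 32 * c ^ 3 * u ^ 3) 8 (by fun_prop) fun u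
      => by ring
  exact ((h1.congr_right fun u => by ring).add h2).congr_left fun u => by
    simp only [frontTan]; ring

theorem frontTan_isBigO (c : ℝ) : frontTan c =O[nhds 0] fun u : ℝ => u := by
  have h1 := (frontTan_expansion c).trans (isBigO_pow_pow (by norm_num : 1 ≤ 8))
  have h2 : (fun u : ℝ => c * u - 1 / 2 * c ^ 2 * u ^ 4 - 1 / 8 * c * u ^ 5
      + 1 / 4 * c ^ 3 * u ^ 7) =O[nhds 0] fun u : ℝ => u ^ 1 :=
    isBigO_pow_of_eq (g := fun u => c - 1 / 2 * c ^ 2 * u ^ 3 - 1 / 8 * c * u ^ 4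
      + 1 / 4 * c ^ 3 * u ^ 6) 1 (by fun_prop) fun u => by ring
  exact ((h1.add h2).congr_left fun u => by ring).congr_right fun u => by ring

/-- The relative correction `u ^ 3 * k` first affects the cube at order `u ^ 6`, with its square at
`u ^ 9`, and the fifth power only at `u ^ 8`. So modulo `u ^ 8` only its linear effect on the cube
survives. -/
theorem arctan_taylor_isBigO (c : ℝ) {k : ℝ → ℝ} (hk : Continuous k) :
    (fun u => c * u * (1 + u ^ 3 * k u) - (c * u * (1 + u ^ 3 * k u)) ^ 3 / 3
        + (c * u * (1 + u ^ 3 * k u)) ^ 5 / 5 - (c * u * (1 + u ^ 3 * k u)) ^ 7 / 7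
      - (c * u * (1 + u ^ 3 * k u) - (c ^ 3 * u ^ 3 + 3 * c ^ 3 * u ^ 6 * k u) / 3
        + c ^ 5 * u ^ 5 / 5 - c ^ 7 * u ^ 7 / 7))
      =O[nhds 0] fun u : ℝ => u ^ 8 := by
  have e3 : ∀ s : ℝ, (1 + s) ^ 3 = 1 + 3 * s + s ^ 2 * (3 + s) := fun s => by ring
  have e5 : ∀ s : ℝ, (1 + s) ^ 5 = 1 + s * (5 + 10 * s + 10 * s ^ 2 + 5 * s ^ 3 + s ^ 4) :=
    fun s => by ring
  have e7 : ∀ s : ℝ, (1 + s) ^ 7 = 1 + s * (7 + 21 * s + 35 * s ^ 2 + 35 * s ^ 3 + 21 * s ^ 4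
    + 7 * s ^ 5 + s ^ 6) := fun s => by ring
  refine isBigO_pow_of_eq (g := fun u => -(c ^ 3 * u * k u ^ 2 * (3 + u ^ 3 * k u)) / 3
    + c ^ 5 * k u * (5 + 10 * (u ^ 3 * k u) + 10 * (u ^ 3 * k u) ^ 2 + 5 * (u ^ 3 * k u) ^ 3
      + (u ^ 3 * k u) ^ 4) / 5
    - c ^ 7 * u ^ 2 * k u * (7 + 21 * (u ^ 3 * k u) + 35 * (u ^ 3 * k u) ^ 2
      + 35 * (u ^ 3 * k u) ^ 3 + 21 * (u ^ 3 * k u) ^ 4 + 7 * (u ^ 3 * k u) ^ 5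
      + (u ^ 3 * k u) ^ 6) / 7) 8 (by fun_prop) fun u => ?_
  simp only [mul_pow (c * u), e3, e5, e7]
  ring

theorem frontAngle_expansion (c : ℝ) :
    (fun u => frontAngle c u - (c * u - 1 / 3 * c ^ 3 * u ^ 3 - 1 / 2 * c ^ 2 * u ^ 4 - 1 / 8 * c
      * u ^ 5 + 1 / 5 * c ^ 5 * u ^ 5 + 1 / 2 * c ^ 4 * u ^ 6 + 3 / 8 * c ^ 3 * u ^ 7 - 1 / 7 * c
      ^ 7 * u ^ 7))
      =O[nhds 0] fun u : ℝ => u ^ 8 := by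
  have hy := frontTan_expansion c
  have hy1 := frontTan_isBigO c
  have hb : frontTan c =O[nhds 0] (1 : ℝ → ℝ) :=
    hy1.trans ((isBigO_pow_one 1).congr_left fun u => by ring)
  set Y : ℝ → ℝ := fun u =>
    c * u - 1 / 2 * c ^ 2 * u ^ 4 - 1 / 8 * c * u ^ 5 + 1 / 4 * c ^ 3 * u ^ 7 with hY
  have hY1 : Y =O[nhds 0] (1 : ℝ → ℝ) := Continuous.isBigO_one_zero (by fun_prop)
  have hp := hy.pow_sub_pow hb hY1
  have h1 : (fun u => frontAngle c u - (frontTan c u - frontTan c u ^ 3 / 3 + frontTan c u ^ 5 / 5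
      - frontTan c u ^ 7 / 7)) =O[nhds 0] fun u : ℝ => u ^ 8 := by
    refine (IsBigO.trans (IsBigO.of_bound 1 (Eventually.of_forall fun u => ?_))
      (hy1.pow 9)).trans (isBigO_pow_pow (by norm_num))
    simpa [frontAngle] using abs_arctan_sub_le (frontTan c u)
  have h2 : (fun u : ℝ => Y u - Y u ^ 3 / 3 + Y u ^ 5 / 5 - Y u ^ 7 / 7 - (c * u - 1 / 3 * c ^ 3 *
    u ^ 3 - 1 / 2 * c ^ 2 * u ^ 4 - 1 / 8 * c * u ^ 5 + 1 / 5 * c ^ 5 * u ^ 5 + 1 / 2 * c ^ 4 * u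
    ^ 6 + 3 / 8 * c ^ 3 * u ^ 7 - 1 / 7 * c ^ 7 * u ^ 7))
      =O[nhds 0] fun u : ℝ => u ^ 8 :=
    ((arctan_taylor_isBigO c (k := fun u => -c / 2 - u / 8 + c ^ 2 * u ^ 3 / 4) (by fun_prop)).add
      -- This is the contribution of the last term of `k` to `-c ^ 3 * u ^ 6 * k`, beyond the order
      -- kept.
      (isBigO_pow_of_eq (f := fun u => -c ^ 5 / 4 * u ^ 9) (g := fun u => -c ^ 5 / 4 * u) 8
        (by fun_prop) fun u => by ring)).congr_left fun u => by
      have e : Y u = c * u * (1 + u ^ 3 * (-c / 2 - u / 8 + c ^ 2 * u ^ 3 / 4)) := by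
        simp only [hY]; ring
      rw [e]; ring
  exact ((((((h1.add hy).sub ((hp 3).const_mul_left (1 / 3))).add
    ((hp 5).const_mul_left (1 / 5))).sub ((hp 7).const_mul_left (1 / 7))).add h2)).congr_left
    fun u => by simp only [hY]; ring

theorem frontAngle_sub_isBigO (c : ℝ) :
    (fun u => frontAngle c u - c * u) =O[nhds 0] fun u : ℝ => u ^ 3 := by
  have h2 : (fun u : ℝ => c * u - 1 / 3 * c ^ 3 * u ^ 3 - 1 / 2 * c ^ 2 * u ^ 4 - 1 / 8 * c * u ^
    5 + 1 / 5 * c ^ 5 * u ^ 5 + 1 / 2 * c ^ 4 * u ^ 6 + 3 / 8 * c ^ 3 * u ^ 7 - 1 / 7 * c ^ 7 * u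
    ^ 7 - c * u) =O[nhds 0] fun u : ℝ => u ^ 3 :=
    isBigO_pow_of_eq (g := fun u => -1 / 3 * c ^ 3 - 1 / 2 * c ^ 2 * u - 1 / 8 * c * u ^ 2 + 1 / 5
      * c ^ 5 * u ^ 2 + 1 / 2 * c ^ 4 * u ^ 3 + 3 / 8 * c ^ 3 * u ^ 4 - 1 / 7 * c ^ 7 * u ^ 4) 3
      (by fun_prop) fun u => by ring
  exact (((frontAngle_expansion c).trans (isBigO_pow_pow (by norm_num))).add h2).congr_left
    fun u => by ring

theorem sqrt_one_add_expansion (c : ℝ) {x : ℝ → ℝ}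
    (hx : (fun u => x u - (c ^ 2 * u ^ 2 + c * u ^ 3)) =O[nhds 0] fun u : ℝ => u ^ 5) :
    (fun u => √(1 + x u) -
      (1 + 1 / 2 * c ^ 2 * u ^ 2 + 1 / 2 * c * u ^ 3 - 1 / 8 * c ^ 4 * u ^ 4))
      =O[nhds 0] fun u : ℝ => u ^ 5 := by
  have h0 : (fun u : ℝ => c ^ 2 * u ^ 2 + c * u ^ 3) =O[nhds 0] fun u : ℝ => u ^ 2 :=
    isBigO_pow_of_eq (g := fun u => c ^ 2 + c * u) 2 (by fun_prop) fun u => by ring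
  have hx2 : x =O[nhds 0] fun u : ℝ => u ^ 2 :=
    ((hx.trans (isBigO_pow_pow (by norm_num))).add h0).congr_left fun u => by ring
  have hsmall : ∀ᶠ u in nhds 0, |x u| ≤ 1 := by
    have ht : Tendsto (fun u : ℝ => u ^ 2) (nhds 0) (nhds 0) := by
      simpa using (continuous_pow 2).tendsto (0 : ℝ)
    have : Tendsto (fun u => |x u|) (nhds 0) (nhds 0) := by
      simpa using (hx2.trans_tendsto ht).abs
    exact (this.eventually_lt_const one_pos).mono fun u hu => hu.le
  have h1 : (fun u => √(1 + x u) - (1 + x u / 2 - x u ^ 2 / 8)) =O[nhds 0] fun u : ℝ => u ^ 5 := by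
    refine (IsBigO.trans (IsBigO.of_bound 1 ?_) ((hx2.pow 3).congr_right fun u => ?_)).trans
      (isBigO_pow_pow (n := 6) (by norm_num))
    · filter_upwards [hsmall] with u hu
      simpa using abs_sqrt_one_add_sub_le hu
    · ring
  have hp := hx.pow_sub_pow (hx2.trans (isBigO_pow_one 2)) (h0.trans (isBigO_pow_one 2)) 2
  have h2 : (fun u : ℝ => 1 + (c ^ 2 * u ^ 2 + c * u ^ 3) / 2 - (c ^ 2 * u ^ 2 + c * u ^ 3) ^ 2 / 8
      - (1 + 1 / 2 * c ^ 2 * u ^ 2 + 1 / 2 * c * u ^ 3 - 1 / 8 * c ^ 4 * u ^ 4))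
      =O[nhds 0] fun u : ℝ => u ^ 5 :=
    isBigO_pow_of_eq (g := fun u => -1 / 4 * c ^ 3 - 1 / 8 * c ^ 2 * u) 5 (by fun_prop) fun u =>
      by ring
  exact (((h1.add (hx.const_mul_left (1 / 2))).sub (hp.const_mul_left (1 / 8))).add h2).congr_left
    fun u => by ring

/-- Both radicands agree with `1 + c ^ 2 * u ^ 2 + c * u ^ 3` up to `O(u ^ 5)`, so one square root
expansion serves for both radii. This order suffices because the gap itself is `O(u ^ 4)`. -/
theorem radiusSum_expansion (c : ℝ) :
    (fun u => radiusSum c u -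
      (2 + c ^ 2 * u ^ 2 + c * u ^ 3 - 1 / 4 * c ^ 4 * u ^ 4))
      =O[nhds 0] fun u : ℝ => u ^ 5 := by
  have hA := sqrt_one_add_expansion c (x := fun u => c ^ 2 * u ^ 2 + c * u ^ 3 * invSpeed u) <| by
    have h1 : (fun u => invSpeed u - 1) =O[nhds 0] fun u : ℝ => u ^ 2 :=
      ((invSpeed_expansion.trans (isBigO_pow_pow (by norm_num : 2 ≤ 8))).sub
        (isBigO_pow_of_eq (f := fun u => u ^ 4 / 8) (g := fun u => u ^ 2 / 8) 2 (by fun_prop)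
          fun u => by ring)).congr_left fun u => by ring
    exact (((isBigO_pow_mul (continuous_const (y := c)) 3).mul h1).congr_right
      fun u => by ring).congr_left fun u => by ring
  have hB := sqrt_one_add_expansion c (x := fun u => c ^ 2 * u ^ 2 + u ^ 2 * frontAngle c u) <|
    (((isBigO_refl (fun u : ℝ => u ^ 2) (nhds 0)).mul (frontAngle_sub_isBigO c)).congr_right
      fun u => by ring).congr_left fun u => by ring
  exact (hA.add hB).congr_left fun u => by simp only [radiusSum]; ring

theorem one_le_radiusSum {c u : ℝ} (hc : 0 ≤ c) (hu : 0 ≤ u) : 1 ≤ radiusSum c u := by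
  have hw : 0 ≤ invSpeed u := by unfold invSpeed; positivity
  have h1 : 1 ≤ √(1 + (c ^ 2 * u ^ 2 + c * u ^ 3 * invSpeed u)) :=
    Real.one_le_sqrt.2 (by have : 0 ≤ c ^ 2 * u ^ 2 + c * u ^ 3 * invSpeed u := by positivity
                           linarith)
  have := Real.sqrt_nonneg (1 + (c ^ 2 * u ^ 2 + u ^ 2 * frontAngle c u))
  unfold radiusSum; linarith

/-- The expansion of the radial gap at `u = 0`. -/
def gapModel (c u : ℝ) : ℝ :=
  c ^ 2 / 6 * u ^ 4 + c / 4 * u ^ 5 - 11 / 60 * c ^ 4 * u ^ 6 - 11 / 24 * c ^ 3 * u ^ 7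
    + (103 / 560 * c ^ 6 - 5 / 16 * c ^ 2) * u ^ 8

theorem radialGap_expansion {c : ℝ} (hc : 0 < c) :
    (fun u => radialGap c u - gapModel c u) =O[nhdsWithin 0 (Set.Ioi 0)] fun u : ℝ => u ^ 9 := by
  have hle : nhdsWithin (0 : ℝ) (Set.Ioi 0) ≤ nhds 0 := nhdsWithin_le_nhds
  have hN : (fun u => c * u * invSpeed u - frontAngle c u - (c * u * (1 - u ^ 4 / 8) - (c * u - 1
    / 3 * c ^ 3 * u ^ 3 - 1 / 2 * c ^ 2 * u ^ 4 - 1 / 8 * c * u ^ 5 + 1 / 5 * c ^ 5 * u ^ 5 + 1 /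
    2 * c ^ 4 * u ^ 6 + 3 / 8 * c ^ 3 * u ^ 7 - 1 / 7 * c ^ 7 * u ^ 7)))
      =O[nhds 0] fun u : ℝ => u ^ 8 := by
    have h1 := ((Continuous.isBigO_one_zero (f := fun u => c * u) (by fun_prop)).mul
      invSpeed_expansion).congr_right (g₂ := fun u => u ^ 8) fun u => by simp
    exact (h1.sub (frontAngle_expansion c)).congr_left fun u => by ring
  have hN' := ((isBigO_pow_of_eq (f := fun u => u / c) (g := fun _ => c⁻¹) 1 (by fun_prop)
    fun u => by ring).mul hN).congr_right (g₂ := fun u => u ^ 9) fun u => by ring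
  have hP : gapModel c =O[nhds 0] fun u : ℝ => u ^ 4 :=
    isBigO_pow_of_eq (g := fun u => c ^ 2 / 6 + c / 4 * u - 11 / 60 * c ^ 4 * u ^ 2
      - 11 / 24 * c ^ 3 * u ^ 3 + (103 / 560 * c ^ 6 - 5 / 16 * c ^ 2) * u ^ 4) 4 (by fun_prop)
      fun u => by simp only [gapModel]; ring
  have hS := (hP.mul (radiusSum_expansion c)).congr_right (g₂ := fun u => u ^ 9) fun u => by ring
  -- The coefficients of `gapModel` are those of the quotient of the two truncations, so everything
  -- below `u ^ 9` cancels.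
  have hR : (fun u : ℝ => u / c * (c * u * (1 - u ^ 4 / 8) - (c * u - 1 / 3 * c ^ 3 * u ^ 3 - 1 /
    2 * c ^ 2 * u ^ 4 - 1 / 8 * c * u ^ 5 + 1 / 5 * c ^ 5 * u ^ 5 + 1 / 2 * c ^ 4 * u ^ 6 + 3 / 8
    * c ^ 3 * u ^ 7 - 1 / 7 * c ^ 7 * u ^ 7)) -
      gapModel c u * (2 + c ^ 2 * u ^ 2 + c * u ^ 3 - 1 / 4 * c ^ 4 * u ^ 4))
      =O[nhds 0] fun u : ℝ => u ^ 9 :=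
    isBigO_pow_of_eq (g := fun u => 169 / 240 * c ^ 5 + 37 / 48 * c ^ 4 * u - 193 / 840 * c ^ 8 *
      u + 5 / 16 * c ^ 3 * u ^ 2 - 1003 / 3360 * c ^ 7 * u ^ 2 - 5 / 64 * c ^ 6 * u ^ 3 + 103 /
      2240 * c ^ 10 * u ^ 3) 9 (by fun_prop) fun u => by
      simp only [gapModel]; field_simp; ring
  have hall := ((hN'.sub hS).add hR).mono hle
  refine IsBigO.trans (IsBigO.of_bound 1 ?_) hall
  filter_upwards [self_mem_nhdsWithin] with u hu
  have hs := one_le_radiusSum hc.le (le_of_lt hu)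
  have hs0 : radiusSum c u ≠ 0 := by linarith
  -- Multiplying the model by the denominator avoids expanding a reciprocal; since `radiusSum` is at
  -- least 1 for `u > 0`, dividing back does no harm.
  have e : radialGap c u - gapModel c u = (u / c * (c * u * invSpeed u - frontAngle c u)
      - gapModel c u * radiusSum c u) / radiusSum c u := by
    unfold radialGap; field_simp
  rw [e, norm_div, one_mul, Real.norm_of_nonneg (by linarith : 0 ≤ radiusSum c u)]
  refine (div_le_self (norm_nonneg _) hs).trans (le_of_eq ?_)
  congr 1
  ring

end

/-! ### Exact formulas for the front point, its angle and the radial gap. -/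

theorem invSpeed_pos (u : ℝ) : 0 < invSpeed u := by
  have : 0 < 1 + u ^ 4 / 4 := by positivity
  unfold invSpeed; positivity

theorem invSpeed_sq (u : ℝ) : invSpeed u ^ 2 * (1 + u ^ 4 / 4) = 1 := by
  have : 0 < 1 + u ^ 4 / 4 := by positivity
  rw [invSpeed, inv_pow, Real.sq_sqrt this.le, inv_mul_cancel₀ this.ne']

theorem invSpeed_le_one (u : ℝ) : invSpeed u ≤ 1 := by
  have h := invSpeed_sq u
  have h0 := invSpeed_pos u
  have : 0 ≤ u ^ 4 := by positivity
  nlinarith [mul_nonneg (sq_nonneg (invSpeed u)) this]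

theorem inv_sqrt_sq {t : ℝ} (ht : 0 < t) : ((√t)⁻¹) ^ 2 = t⁻¹ := by
  rw [inv_pow, Real.sq_sqrt ht.le]

theorem hasDerivAt_F₁ {t : ℝ} (ht : 0 < t) :
    HasDerivAt F₁ (√(t / (2 * π)) •
      !₂[(2 * t)⁻¹ * cos t - sin t, (2 * t)⁻¹ * sin t + cos t]) t := by
  have h0 : 0 < t / (2 * π) := by positivity
  have hs : HasDerivAt (fun t : ℝ => √(t / (2 * π))) (√(t / (2 * π)) * (2 * t)⁻¹) t := by
    refine (((hasDerivAt_id t).div_const (2 * π)).sqrt h0.ne').congr_deriv ?_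
    have h1 := Real.sq_sqrt h0.le
    have h2 : 0 < √(t / (2 * π)) := Real.sqrt_pos.2 h0
    simp only [id]
    rw [div_eq_iff (by positivity)]
    have : √(t / (2 * π)) * (2 * t)⁻¹ * (2 * √(t / (2 * π))) = √(t / (2 * π)) ^ 2 * t⁻¹ := by
      field_simp
    rw [this, h1]; field_simp
  rw [hasDerivAt_iff_hasFDerivAt, ← hasFDerivWithinAt_univ, hasFDerivWithinAt_euclidean]
  intro i
  rw [hasFDerivWithinAt_univ, hasFDerivAt_iff_hasDerivAt]
  fin_cases i
  · refine ((hs.mul (hasDerivAt_cos t)).congr_deriv ?_).congr_of_eventuallyEq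
      (Eventually.of_forall fun s => ?_)
    · simp; ring
    · simp [F₁]
  · refine ((hs.mul (hasDerivAt_sin t)).congr_deriv ?_).congr_of_eventuallyEq
      (Eventually.of_forall fun s => ?_)
    · simp; ring
    · simp [F₁]

theorem norm_deriv_F₁ {t : ℝ} (ht : 0 < t) :
    ‖deriv F₁ t‖ = √(t / (2 * π)) * (invSpeed (√t)⁻¹)⁻¹ := by
  rw [(hasDerivAt_F₁ ht).deriv, norm_smul, Real.norm_of_nonneg (Real.sqrt_nonneg _)]
  congr 1
  rw [invSpeed, inv_inv, EuclideanSpace.norm_eq]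
  congr 1
  have h4 : ((√t)⁻¹) ^ 4 = t⁻¹ ^ 2 := by rw [← inv_sqrt_sq ht]; ring
  rw [h4]
  simp only [Fin.sum_univ_two, Real.norm_eq_abs, sq_abs]
  simp
  field_simp
  linear_combination 4 * (4 * t ^ 2 + 1) * Real.sin_sq_add_cos_sq t

theorem F₀_eq {t : ℝ} (ht : 0 < t) :
    F₀ t = !₂[(√(t / (2 * π)) + invSpeed (√t)⁻¹ * (2 * t)⁻¹) * cos t - invSpeed (√t)⁻¹ * sin t,
      (√(t / (2 * π)) + invSpeed (√t)⁻¹ * (2 * t)⁻¹) * sin t + invSpeed (√t)⁻¹ * cos t] := by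
  have h0 : 0 < √(t / (2 * π)) := Real.sqrt_pos.2 (by positivity)
  rw [F₀, frontTrack, norm_deriv_F₁ ht, (hasDerivAt_F₁ ht).deriv, smul_smul, mul_inv, inv_inv,
    mul_right_comm, inv_mul_cancel₀ h0.ne', one_mul, F₁]
  ext i; fin_cases i <;> simp <;> ring

theorem R₀_sq {t : ℝ} (ht : 0 < t) :
    R₀ t ^ 2 = t / (2 * π) + √(t / (2 * π)) * invSpeed (√t)⁻¹ * t⁻¹ + 1 := by
  have hw := invSpeed_sq (√t)⁻¹
  have h4 : ((√t)⁻¹) ^ 4 = t⁻¹ ^ 2 := by rw [← inv_sqrt_sq ht]; ring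
  have hr := Real.sq_sqrt (show 0 ≤ t / (2 * π) by positivity)
  rw [h4] at hw
  rw [R₀, F₀_eq ht, EuclideanSpace.norm_eq, Real.sq_sqrt (by positivity)]
  simp only [Fin.sum_univ_two, Real.norm_eq_abs, sq_abs]
  simp
  have e : invSpeed (√t)⁻¹ ^ 2 * (1 + (t⁻¹ * 2⁻¹) ^ 2) = 1 := by
    linear_combination hw
  have hsc := Real.sin_sq_add_cos_sq t
  set w := invSpeed (√t)⁻¹
  linear_combination ((√(t / (2 * π)) + w * (t⁻¹ * 2⁻¹)) ^ 2 + w ^ 2) * hsc + hr + e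

/-- In the frame rotated by `t` the front point has positive coordinates `a`, `w`, so its angle is
`arctan (w / a)`; this lies below `π / 2` and is thus already the representative in `[0, 2π)`. -/
theorem β_eq {t : ℝ} (ht : 0 < t) : β t = frontAngle √(2 * π) (√t)⁻¹ := by
  have hst : 0 < √t := Real.sqrt_pos.2 ht
  have hc : 0 < √(2 * π) := Real.sqrt_pos.2 two_pi_pos
  have hw := invSpeed_pos (√t)⁻¹
  set w := invSpeed (√t)⁻¹ with hwdef
  set a := √(t / (2 * π)) + w * (2 * t)⁻¹ with ha
  have ha0 : 0 < a := by positivity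
  have hx : frontTan √(2 * π) (√t)⁻¹ = w / a := by
    have e : t = √t ^ 2 := (Real.sq_sqrt ht.le).symm
    rw [frontTan, ← hwdef, ha, Real.sqrt_div ht.le]
    have : (2 * t)⁻¹ = (2 * √t ^ 2)⁻¹ := by rw [← e]
    rw [this]
    field_simp
  set x := frontTan √(2 * π) (√t)⁻¹ with hxdef
  have hx0 : 0 < x := by rw [hx]; positivity
  have hb : frontAngle √(2 * π) (√t)⁻¹ = arctan x := rfl
  have hs : 0 < √(1 + x ^ 2) := Real.sqrt_pos.2 (by positivity)
  have hac : a = a * √(1 + x ^ 2) * cos (arctan x) := by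
    rw [cos_arctan]; field_simp
  have hws : w = a * √(1 + x ^ 2) * sin (arctan x) := by
    rw [sin_arctan, hx]; field_simp
  have hz : (⟨F₀ t 0, F₀ t 1⟩ : ℂ) = ((a * √(1 + x ^ 2) : ℝ) : ℂ) *
      (Complex.cos ((t + arctan x : ℝ) : ℂ) + Complex.sin ((t + arctan x : ℝ) : ℂ) * Complex.I) := by
    have h0 : F₀ t 0 = a * √(1 + x ^ 2) * cos (t + arctan x) := by
      rw [F₀_eq ht, cos_add]
      simp only [Matrix.cons_val_zero]
      rw [← hwdef, ← ha]
      linear_combination cos t * hac - sin t * hws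
    have h1 : F₀ t 1 = a * √(1 + x ^ 2) * sin (t + arctan x) := by
      rw [F₀_eq ht, sin_add]
      simp only [Matrix.cons_val_one]
      simp only [Matrix.cons_val_fin_one]
      rw [← hwdef, ← ha]
      linear_combination sin t * hac + cos t * hws
    generalize t + arctan x = φ at *
    apply Complex.ext <;> simp [h0, h1, Complex.cos_ofReal_re, Complex.sin_ofReal_re]
  rw [β, hz, Complex.arg_mul_cos_add_sin_mul_I_eq_toIocMod (by positivity), hb,
    toIcoMod_eq_iff]
  refine ⟨⟨(arctan_pos.2 hx0).le, ?_⟩, -toIocDiv two_pi_pos (-π) (t + arctan x), ?_⟩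
  · have := arctan_lt_pi_div_two x
    linarith [pi_pos]
  · rw [← self_sub_toIocDiv_zsmul, neg_smul]; ring

theorem frontTan_pos {c u : ℝ} (hc : 0 < c) (hu : 0 < u) : 0 < frontTan c u := by
  have := invSpeed_pos u
  unfold frontTan; positivity

theorem frontAngle_pos {c u : ℝ} (hc : 0 < c) (hu : 0 < u) : 0 < frontAngle c u :=
  arctan_pos.2 (frontTan_pos hc hu)

theorem frontAngle_le {c u : ℝ} (hc : 0 < c) (hu : 0 < u) :
    frontAngle c u ≤ c * u * invSpeed u := by
  have hw := invSpeed_pos u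
  refine ((le_tan (frontAngle_pos hc hu).le (arctan_lt_pi_div_two _)).trans_eq (tan_arctan _)).trans ?_
  rw [frontTan, mul_le_mul_iff_right₀ (by positivity)]
  exact mul_le_of_le_one_right hw.le (inv_le_one_of_one_le₀ (by
    have : 0 ≤ c * u ^ 3 * invSpeed u / 2 := by positivity
    linarith))

theorem β_pos {t : ℝ} (ht : 0 < t) : 0 < β t := by
  have hst : 0 < (√t)⁻¹ := inv_pos.2 (Real.sqrt_pos.2 ht)
  have hc : 0 < √(2 * π) := Real.sqrt_pos.2 two_pi_pos
  rw [β_eq ht]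
  exact frontAngle_pos hc hst

theorem R₁_eq (t : ℝ) : R₁ t = √(t / (2 * π)) := norm_F₁ t

/-- A difference of squares divided by the sum of the radii; the extra turn in `α t` cancels the 1
in `R₀_sq`. -/
theorem R₀_sub_R₁ {t : ℝ} (ht : 0 < t) :
    R₀ t - R₁ (α t) = radialGap √(2 * π) (√t)⁻¹ := by
  have hst : 0 < √t := Real.sqrt_pos.2 ht
  have hc : 0 < √(2 * π) := Real.sqrt_pos.2 two_pi_pos
  have hc2 := Real.sq_sqrt two_pi_pos.le
  have hR := R₀_sq ht
  have hβ := β_pos ht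
  have hw := invSpeed_pos (√t)⁻¹
  have hut : t = ((√t)⁻¹ ^ 2)⁻¹ := by rw [inv_sqrt_sq ht, inv_inv]
  have hs : √(t / (2 * π)) = (√(2 * π) * (√t)⁻¹)⁻¹ := by
    rw [Real.sqrt_div ht.le, mul_inv, inv_inv]; field_simp
  rw [hs] at hR
  have hα : α t = t + 2 * π + frontAngle √(2 * π) (√t)⁻¹ := by rw [α, β_eq ht]
  rw [β_eq ht] at hβ
  have hu0 : 0 < (√t)⁻¹ := inv_pos.2 hst
  rw [R₁_eq, hα]
  set u := (√t)⁻¹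
  set c := √(2 * π)
  set b := frontAngle c u with hb
  have hcu : 0 < c * u := mul_pos hc hu0
  have hA : √(1 + (c ^ 2 * u ^ 2 + c * u ^ 3 * invSpeed u)) = c * u * R₀ t := by
    rw [← Real.sqrt_sq (mul_nonneg hcu.le (norm_nonneg (F₀ t)) : 0 ≤ c * u * R₀ t), mul_pow, hR,
      ← hc2, hut]
    congr 1
    field_simp
    ring
  have hB : √(1 + (c ^ 2 * u ^ 2 + u ^ 2 * b)) = c * u * √((t + 2 * π + b) / (2 * π)) := by
    have h0 : 0 ≤ (t + 2 * π + b) / (2 * π) := by positivity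
    rw [← Real.sqrt_sq (mul_nonneg hcu.le (Real.sqrt_nonneg _)), mul_pow, Real.sq_sqrt h0, ← hc2,
      hut]
    congr 1
    field_simp
    ring
  have hS : radiusSum c u = c * u * (R₀ t + √((t + 2 * π + b) / (2 * π))) := by
    rw [radiusSum, hA, hB]; ring
  have hB2 := Real.sq_sqrt (show 0 ≤ (t + 2 * π + b) / (2 * π) by positivity)
  have hS1 : 0 < radiusSum c u := by linarith [one_le_radiusSum hc.le hu0.le]
  rw [radialGap, eq_div_iff hS1.ne', hS]
  have : (R₀ t - √((t + 2 * π + b) / (2 * π))) * (c * u * (R₀ t + √((t + 2 * π + b) / (2 * π))))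
      = c * u * (R₀ t ^ 2 - √((t + 2 * π + b) / (2 * π)) ^ 2) := by ring
  rw [this, hR, hB2, ← hc2, hut]
  field_simp
  ring

/-! ### Distances in polar coordinates, the upper bound and the tangent line. -/

theorem sq_dist_polar (a b φ ψ : ℝ) :
    dist (a • !₂[cos φ, sin φ] : Plane) (b • !₂[cos ψ, sin ψ]) ^ 2
      = (a - b * cos (ψ - φ)) ^ 2 + (b * sin (ψ - φ)) ^ 2 := by
  rw [EuclideanSpace.dist_eq, Real.sq_sqrt (by positivity), cos_sub, sin_sub]
  simp only [Fin.sum_univ_two, Real.dist_eq, sq_abs]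
  simp
  linear_combination (-b ^ 2 * (sin ψ ^ 2 + cos ψ ^ 2)) * sin_sq_add_cos_sq φ
    + a ^ 2 * sin_sq_add_cos_sq φ

theorem R₁_sq {t : ℝ} (ht : 0 ≤ t) : R₁ t ^ 2 = t / (2 * π) := by
  rw [R₁_eq, Real.sq_sqrt (by positivity)]

theorem R₁_nonneg (t : ℝ) : 0 ≤ R₁ t := norm_nonneg _

theorem R₁_pos {t : ℝ} (ht : 0 < t) : 0 < R₁ t := by
  rw [R₁_eq]; positivity

theorem F₁_eq_polar (t : ℝ) : F₁ t = R₁ t • !₂[cos t, sin t] := by rw [R₁_eq, F₁]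

theorem lt_α {t : ℝ} (ht : 0 < t) : t + 2 * π < α t := by
  have := β_pos ht
  rw [α]; linarith

theorem α_lt {t : ℝ} (ht : 0 < t) : α t < t + 4 * π := by
  have : β t < π / 2 := by rw [β_eq ht]; exact arctan_lt_pi_div_two _
  rw [α]; linarith [pi_pos]

theorem R₁_α_le_R₀ {t : ℝ} (ht : 0 < t) : 0 ≤ R₀ t - R₁ (α t) := by
  have hc : 0 < √(2 * π) := Real.sqrt_pos.2 two_pi_pos
  have hu : 0 < (√t)⁻¹ := inv_pos.2 (Real.sqrt_pos.2 ht)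
  rw [R₀_sub_R₁ ht, radialGap]
  have := frontAngle_le hc hu
  have := one_le_radiusSum hc.le hu.le
  exact div_nonneg (mul_nonneg (by positivity) (by linarith)) (by linarith)

theorem dist_F₀_F₁_α {t : ℝ} (ht : 0 < t) : dist (F₀ t) (F₁ (α t)) = R₀ t - R₁ (α t) := by
  have h : dist (F₀ t) (F₁ (α t)) ^ 2 = (R₀ t - R₁ (α t)) ^ 2 := by
    rw [F₀_eq_polar, F₁_eq_polar, sq_dist_polar]; simp
  exact (sq_eq_sq₀ dist_nonneg (R₁_α_le_R₀ ht)).1 h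

theorem E₁_le {t : ℝ} (ht : 0 < t) : E₁ t ≤ R₀ t - R₁ (α t) := by
  rw [← dist_F₀_F₁_α ht]
  refine infDist_le_dist_of_mem (Set.mem_image_of_mem F₁ ?_)
  have := lt_α ht
  simp only [Set.mem_Ici]; linarith

theorem inv_sqrt_pow_four {t : ℝ} (ht : 0 < t) : ((√t)⁻¹) ^ 4 = t⁻¹ ^ 2 := by
  rw [← inv_sqrt_sq ht]; ring

theorem sq_dist_tangent {t : ℝ} (ht : 0 < t) (k : ℝ) :
    dist (F₀ t) (F₁ (α t) + k • deriv F₁ (α t)) ^ 2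
      = (R₀ t - R₁ (α t) - k * R₁ (α t) * (2 * α t)⁻¹) ^ 2 + (k * R₁ (α t)) ^ 2 := by
  have hα : 0 < α t := by linarith [lt_α ht, pi_pos]
  rw [(hasDerivAt_F₁ hα).deriv, ← R₁_eq, F₀_eq_polar, F₁_eq_polar (α t), EuclideanSpace.dist_eq,
    Real.sq_sqrt (by positivity)]
  simp only [Fin.sum_univ_two, Real.dist_eq, sq_abs]
  simp
  linear_combination ((R₀ t - R₁ (α t) - k * R₁ (α t) * ((α t)⁻¹ * 2⁻¹)) ^ 2
    + (k * R₁ (α t)) ^ 2) * sin_sq_add_cos_sq (α t)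

theorem sq_invSpeed_mul {t : ℝ} (ht : 0 < t) :
    invSpeed (√t)⁻¹ ^ 2 * (1 + (2 * t)⁻¹ ^ 2) = 1 := by
  have := invSpeed_sq (√t)⁻¹
  rw [inv_sqrt_pow_four ht] at this
  linear_combination this

/-- A point with coordinates `x`, `y` has distance at least `w * |x + ε * y|` from the origin when
`w ^ 2 * (1 + ε ^ 2) = 1`. -/
theorem mul_sq_le_of_unit {w ε x y : ℝ} (hw : w ^ 2 * (1 + ε ^ 2) = 1) :
    (w * (x + ε * y)) ^ 2 ≤ x ^ 2 + y ^ 2 := by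
  have : x ^ 2 + y ^ 2 - (w * (x + ε * y)) ^ 2 = w ^ 2 * (y - ε * x) ^ 2 := by
    linear_combination (-(x ^ 2 + y ^ 2)) * hw
  nlinarith [mul_nonneg (sq_nonneg w) (sq_nonneg (y - ε * x))]

theorem lineDist_eq {t : ℝ} (ht : 0 < t) :
    lineDist (F₁ (α t)) (F₁ (α t) + deriv F₁ (α t)) (F₀ t)
      = (R₀ t - R₁ (α t)) * invSpeed (√(α t))⁻¹ := by
  have hα : 0 < α t := by linarith [lt_α ht, pi_pos]
  have hw := sq_invSpeed_mul hα
  have hw0 := invSpeed_pos (√(α t))⁻¹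
  have hD := R₁_α_le_R₀ ht
  have hr := R₁_pos hα
  have hmap : ∀ k : ℝ, AffineMap.lineMap (F₁ (α t)) (F₁ (α t) + deriv F₁ (α t)) k
      = F₁ (α t) + k • deriv F₁ (α t) := fun k => by
    rw [AffineMap.lineMap_apply]; simp [add_comm]
  have hsq := sq_dist_tangent ht
  set w := invSpeed (√(α t))⁻¹
  set D := R₀ t - R₁ (α t)
  set ε := (2 * α t)⁻¹
  apply le_antisymm
  -- This parameter is the foot of the perpendicular: it minimizes `(D - k R₁ ε) ^ 2 + (k R₁) ^ 2`,
  -- as `w ^ 2 = 1 / (1 + ε ^ 2)`.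
  · have hk := hsq (D * ε * w ^ 2 / R₁ (α t))
    have : (D - D * ε * w ^ 2 / R₁ (α t) * R₁ (α t) * ε) ^ 2
        + (D * ε * w ^ 2 / R₁ (α t) * R₁ (α t)) ^ 2 = (D * w) ^ 2 := by
      rw [div_mul_cancel₀ _ hr.ne']
      linear_combination (D ^ 2 * ε ^ 2 * w ^ 2 - D ^ 2) * hw
    rw [this] at hk
    rw [← (sq_eq_sq₀ dist_nonneg (mul_nonneg hD hw0.le)).1 hk, ← hmap]
    exact infDist_le_dist_of_mem (AffineMap.lineMap_mem_affineSpan_pair _ _ _)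
  · refine (le_infDist ⟨_, left_mem_affineSpan_pair ℝ _ _⟩).2 fun y hy => ?_
    rw [← vsub_vadd y (F₁ (α t)), SetLike.mem_coe, vadd_left_mem_affineSpan_pair] at hy
    obtain ⟨k, hk⟩ := hy
    have hy' : y = F₁ (α t) + k • deriv F₁ (α t) := by
      simp only [vsub_eq_sub, add_sub_cancel_left] at hk
      rw [hk]; abel
    rw [hy']
    refine le_of_sq_le_sq ?_ dist_nonneg
    rw [hsq]
    have := mul_sq_le_of_unit (x := D - k * R₁ (α t) * ε) (y := k * R₁ (α t)) hw
    refine le_trans (le_of_eq ?_) this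
    ring

/-! ### The lower bound for the error. -/

theorem mul_cos_le_sin {θ : ℝ} (h0 : 0 ≤ θ) (hπ : θ ≤ π) : θ * cos θ ≤ sin θ := by
  rcases lt_or_ge θ (π / 2) with h | h
  · have hc : 0 < cos θ := cos_pos_of_mem_Ioo ⟨by linarith [pi_pos], h⟩
    have := le_tan h0 h
    rwa [tan_eq_sin_div_cos, le_div_iff₀ hc] at this
  · have := cos_nonpos_of_pi_div_two_le_of_le h (by linarith [pi_pos])
    have := sin_nonneg_of_nonneg_of_le_pi h0 hπ
    nlinarith

/-- The spiral stays on the inner side of its tangent line for half a turn. -/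
theorem R₁_mul_le {a θ : ℝ} (ha : 0 < a) (h0 : 0 ≤ θ) (hπ : θ ≤ π) :
    R₁ (a + θ) * (cos θ - (2 * a)⁻¹ * sin θ) ≤ R₁ a := by
  rcases le_or_gt (cos θ - (2 * a)⁻¹ * sin θ) 0 with h | h
  · exact (mul_nonpos_of_nonneg_of_nonpos (R₁_nonneg _) h).trans (R₁_nonneg _)
  have hε : 0 < (2 * a)⁻¹ := by positivity
  -- By concavity of the square root, the radius stays below its linearization at `a`.
  have hr : R₁ (a + θ) ≤ R₁ a * (1 + (2 * a)⁻¹ * θ) := by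
    refine le_of_sq_le_sq ?_ (mul_nonneg (R₁_nonneg _) (by positivity))
    rw [mul_pow, R₁_sq (by linarith), R₁_sq ha.le, div_mul_eq_mul_div]
    gcongr
    have : a * (1 + (2 * a)⁻¹ * θ) ^ 2 = a + θ + a * ((2 * a)⁻¹ * θ) ^ 2 := by
      field_simp; ring
    rw [this]
    have : 0 ≤ a * ((2 * a)⁻¹ * θ) ^ 2 := by positivity
    linarith
  refine (mul_le_mul_of_nonneg_right hr h.le).trans ?_
  rw [mul_assoc]
  refine mul_le_of_le_one_right (R₁_nonneg _) ?_
  have h1 := mul_cos_le_sin h0 hπ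
  have h2 := sin_nonneg_of_nonneg_of_le_pi h0 hπ
  have h3 := cos_le_one θ
  have : (1 + (2 * a)⁻¹ * θ) * (cos θ - (2 * a)⁻¹ * sin θ)
      = cos θ - (2 * a)⁻¹ * (sin θ - θ * cos θ) - (2 * a)⁻¹ ^ 2 * (θ * sin θ) := by ring
  rw [this]
  have := mul_nonneg hε.le (sub_nonneg.2 h1)
  have : 0 ≤ (2 * a)⁻¹ ^ 2 * (θ * sin θ) := by positivity
  linarith

/-- The product is at most `R₀ ^ 2 - R₁ (α t) ^ 2`, hence at most the cross term of `R₀_sq`. The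
threshold 64 makes `√t ≤ t / 8`. -/
theorem gap_mul_R₀_le {t : ℝ} (ht : 64 ≤ t) : (R₀ t - R₁ (α t)) * R₀ t ≤ 1 / 8 := by
  have ht0 : 0 < t := by linarith
  have hα := lt_α ht0
  have hD := R₁_α_le_R₀ ht0
  have h0 := R₀_sq ht0
  have h1 := R₁_sq (show 0 ≤ α t by linarith [pi_pos])
  have h2 : t / (2 * π) + 1 ≤ R₁ (α t) ^ 2 := by
    rw [h1, div_add_one two_pi_pos.ne']; gcongr
  have h3 : (R₀ t - R₁ (α t)) * R₀ t ≤ R₀ t ^ 2 - R₁ (α t) ^ 2 := by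
    nlinarith [mul_nonneg hD (R₁_nonneg (α t))]
  have h4 : √(t / (2 * π)) * invSpeed (√t)⁻¹ * t⁻¹ ≤ 1 / 8 := by
    have h5 : √(t / (2 * π)) ≤ t / 8 := by
      refine Real.sqrt_le_iff.2 ⟨by positivity, ?_⟩
      have : t / (2 * π) ≤ t := div_le_self ht0.le (by linarith [pi_gt_three])
      nlinarith
    have h6 : √(t / (2 * π)) * invSpeed (√t)⁻¹ ≤ t / 8 :=
      (mul_le_of_le_one_right (Real.sqrt_nonneg _) (invSpeed_le_one _)).trans h5
    calc _ ≤ t / 8 * t⁻¹ := by gcongr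
      _ = 1 / 8 := by field_simp
  linarith

theorem lineDist_le_E₁ {t : ℝ} (ht : 64 ≤ t) :
    lineDist (F₁ (α t)) (F₁ (α t) + deriv F₁ (α t)) (F₀ t) ≤ E₁ t := by
  have ht0 : 0 < t := by linarith
  obtain ⟨s, hs, hE, -⟩ := exists_closest_point t
  have hs0 : 0 < s := by linarith [pi_pos]
  have hα : 0 < α t := by linarith [lt_α ht0, pi_pos]
  have hw := sq_invSpeed_mul hα
  have hw0 := invSpeed_pos (√(α t))⁻¹
  have hD := R₁_α_le_R₀ ht0
  have hDw : (R₀ t - R₁ (α t)) * invSpeed (√(α t))⁻¹ ≤ R₀ t - R₁ (α t) :=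
    mul_le_of_le_one_right hD (invSpeed_le_one _)
  have hdist : |R₀ t - R₁ s| ≤ dist (F₀ t) (F₁ s) := by
    rw [dist_eq_norm]; exact abs_norm_sub_norm_le _ _
  rw [lineDist_eq ht0, hE]
  rcases le_total s (α t) with h | h
  · refine hDw.trans (le_trans ?_ ((le_abs_self _).trans hdist))
    have : R₁ s ≤ R₁ (α t) := by
      rw [R₁_eq, R₁_eq]; gcongr
    linarith
  rcases le_total s (α t + π) with h' | h'
  · refine le_of_sq_le_sq ?_ dist_nonneg
    rw [F₀_eq_polar, F₁_eq_polar s, sq_dist_polar]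
    have h1 := R₁_mul_le hα (sub_nonneg.2 h) (by linarith : s - α t ≤ π)
    rw [add_sub_cancel] at h1
    -- The distance is at least its component along the unit normal `w * (1, -ε)` of the tangent at
    -- `α t`, where `ε = 1 / (2 α t)`.
    have h2 := mul_sq_le_of_unit (x := R₀ t - R₁ s * cos (s - α t))
      (y := R₁ s * sin (s - α t)) hw
    refine le_trans ?_ h2
    rw [mul_comm]
    gcongr
    linarith
  · refine hDw.trans (le_trans ?_ ((neg_le_abs _).trans hdist))
    -- With `D = R₀ - R₁ (α t)`, `(R₀ + D) ^ 2 = R₁ (α t) ^ 2 + 4 * D * R₀`, and `4 * D * R₀ ≤ 1/2`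
    -- is what half a turn adds to `R₁ ^ 2`.
    have : R₀ t + (R₀ t - R₁ (α t)) ≤ R₁ s := by
      refine le_of_sq_le_sq ?_ (R₁_nonneg s)
      have h1 := R₁_sq hα.le
      have h2 : R₁ (α t) ^ 2 + 1 / 2 ≤ R₁ s ^ 2 := by
        rw [R₁_sq hs0.le, h1]
        have : α t / (2 * π) + 1 / 2 = (α t + π) / (2 * π) := by field_simp
        rw [this]; gcongr
      nlinarith [gap_mul_R₀_le ht]
    linarith

/-! ### Transfer to `t → ∞` and the final expansions. -/

theorem tendsto_inv_sqrt_atTop :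
    Tendsto (fun t : ℝ => (√t)⁻¹) atTop (nhdsWithin 0 (Set.Ioi 0)) :=
  tendsto_inv_atTop_nhdsGT_zero.comp tendsto_sqrt_atTop

theorem inv_sqrt_pow {t : ℝ} (ht : 0 ≤ t) (n : ℕ) : ((√t)⁻¹) ^ n = t ^ (-(n / 2 : ℝ)) := by
  rw [Real.sqrt_eq_rpow, ← rpow_neg ht, ← rpow_natCast, ← rpow_mul ht]
  congr 1; ring

theorem gapModel_inv_sqrt {t : ℝ} (ht : 0 ≤ t) :
    gapModel √(2 * π) (√t)⁻¹
      = errorModel t + (103 / 70 * π ^ 2 - 5 / 8) * π * t ^ (-4 : ℝ) := by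
  have h2 : √2 ^ 2 = 2 := Real.sq_sqrt zero_le_two
  have hπ2 : √π ^ 2 = π := Real.sq_sqrt pi_pos.le
  have h20 : √2 ≠ 0 := by positivity
  have hc : √(2 * π) ^ 2 = 2 * π := Real.sq_sqrt two_pi_pos.le
  have hc4 : √(2 * π) ^ 4 = 4 * π ^ 2 := by linear_combination (√(2 * π) ^ 2 + 2 * π) * hc
  have hc6 : √(2 * π) ^ 6 = 8 * π ^ 3 := by
    linear_combination √(2 * π) ^ 4 * hc + 2 * π * hc4
  have hc1 : √(2 * π) = √2 * √π := Real.sqrt_mul zero_le_two π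
  have hp1 : π ^ (1 / 2 : ℝ) = √π := (Real.sqrt_eq_rpow π).symm
  have hp3 : π ^ (3 / 2 : ℝ) = √π ^ 3 := by
    rw [Real.sqrt_eq_rpow, ← rpow_natCast, ← rpow_mul pi_pos.le]; norm_num
  have e4 := inv_sqrt_pow ht 4
  have e5 := inv_sqrt_pow ht 5
  have e6 := inv_sqrt_pow ht 6
  have e7 := inv_sqrt_pow ht 7
  have e8 := inv_sqrt_pow ht 8
  norm_num at e4 e5 e6 e7 e8
  have k5 : √(2 * π) / 4 = 1 / (2 * √2) * √π := by
    rw [hc1]; field_simp; linear_combination 2 * h2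
  have k7 : 11 / 24 * √(2 * π) ^ 3 = 11 / (6 * √2) * √π ^ 3 := by
    rw [hc1]; field_simp; linear_combination 6 * (√2 ^ 2 + 2) * h2
  rw [gapModel, errorModel, hc, hc4, hc6, hp1, hp3, k5, k7, inv_pow, inv_pow, inv_pow, inv_pow,
    inv_pow, e4, e5, e6, e7, e8]
  norm_num
  ring

theorem isBigO_of_inv_sqrt {f g : ℝ → ℝ} {n : ℕ} {r : ℝ} (hr : -(n / 2 : ℝ) = r)
    (h : f =O[nhdsWithin 0 (Set.Ioi 0)] fun u : ℝ => u ^ n)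
    (hfg : ∀ t, 0 < t → f (√t)⁻¹ = g t) : g =O[atTop] fun t : ℝ => t ^ r := by
  refine (h.comp_tendsto tendsto_inv_sqrt_atTop).congr' ?_ ?_
  · filter_upwards [eventually_gt_atTop 0] with t ht using hfg t ht
  · filter_upwards [eventually_gt_atTop 0] with t ht
    rw [Function.comp_apply, inv_sqrt_pow ht.le, hr]

theorem R₀_sub_R₁_expansion :
    (fun t : ℝ => R₀ t - R₁ (α t) -
      (errorModel t + (103 / 70 * π ^ 2 - 5 / 8) * π * t ^ (-4 : ℝ)))
      =O[atTop] fun t : ℝ => t ^ (-(9 / 2) : ℝ) :=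
  isBigO_of_inv_sqrt (by norm_num) (radialGap_expansion (Real.sqrt_pos.2 two_pi_pos))
    fun t ht => by rw [R₀_sub_R₁ ht, gapModel_inv_sqrt ht.le]

theorem isBigO_rpow_rpow {a b : ℝ} (h : a ≤ b) :
    (fun t : ℝ => t ^ a) =O[atTop] fun t : ℝ => t ^ b := by
  refine IsBigO.of_bound 1 ?_
  filter_upwards [eventually_ge_atTop 1] with t ht
  rw [one_mul, Real.norm_of_nonneg (by positivity), Real.norm_of_nonneg (by positivity)]
  exact rpow_le_rpow_of_exponent_le ht h

theorem invSpeed_α_expansion :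
    (fun t : ℝ => invSpeed (√(α t))⁻¹ - 1 + 1 / 8 * t ^ (-2 : ℝ))
      =O[atTop] fun t : ℝ => t ^ (-3 : ℝ) := by
  -- `π` comes from replacing `α t` by `t` in the quadratic term, as `α t - t < 4π`; 1 covers the
  -- Taylor remainder.
  refine IsBigO.of_bound (π + 1) ?_
  filter_upwards [eventually_ge_atTop 1] with t ht
  have ht0 : 0 < t := by linarith
  have h1 := lt_α ht0
  have h2 := α_lt ht0
  have hα : 0 < α t := by linarith [pi_pos]
  have hw := abs_inv_sqrt_one_add_sub_le (v := (√(α t))⁻¹ ^ 4 / 4) (by positivity)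
  change |invSpeed (√(α t))⁻¹ - _| ≤ _ at hw
  rw [inv_sqrt_pow_four hα] at hw
  have e2 : t ^ (-2 : ℝ) = t⁻¹ ^ 2 := by
    rw [rpow_neg ht0.le, inv_pow]; norm_cast
  have e3 : t ^ (-3 : ℝ) = t⁻¹ ^ 3 := by
    rw [rpow_neg ht0.le, inv_pow]; norm_cast
  rw [e2, e3, Real.norm_eq_abs, Real.norm_of_nonneg (by positivity)]
  have ha : (α t)⁻¹ ≤ t⁻¹ := by gcongr; linarith [pi_pos]
  have ha0 : 0 < (α t)⁻¹ := by positivity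
  have ht1 : t⁻¹ ≤ 1 := inv_le_one_of_one_le₀ ht
  have hti : 0 < t⁻¹ := by positivity
  have hd : t⁻¹ - (α t)⁻¹ ≤ 4 * π * t⁻¹ ^ 2 := by
    have : t⁻¹ - (α t)⁻¹ = (α t - t) * (t⁻¹ * (α t)⁻¹) := by field_simp
    rw [this]
    calc (α t - t) * (t⁻¹ * (α t)⁻¹) ≤ (4 * π) * (t⁻¹ * t⁻¹) := by gcongr; linarith
      _ = _ := by ring
  have hd2 : t⁻¹ ^ 2 - (α t)⁻¹ ^ 2 ≤ 8 * π * t⁻¹ ^ 3 := by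
    calc t⁻¹ ^ 2 - (α t)⁻¹ ^ 2 = (t⁻¹ - (α t)⁻¹) * (t⁻¹ + (α t)⁻¹) := by ring
      _ ≤ (4 * π * t⁻¹ ^ 2) * (t⁻¹ + t⁻¹) := by gcongr
      _ = _ := by ring
  have hd3 : (α t)⁻¹ ^ 2 ≤ t⁻¹ ^ 2 := by gcongr
  have h4 : ((α t)⁻¹ ^ 2 / 4) ^ 2 ≤ t⁻¹ ^ 3 := by
    calc ((α t)⁻¹ ^ 2 / 4) ^ 2 ≤ (t⁻¹ ^ 2 / 4) ^ 2 := by gcongr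
      _ = t⁻¹ ^ 3 * (t⁻¹ / 16) := by ring
      _ ≤ t⁻¹ ^ 3 * 1 := by gcongr; linarith
      _ = _ := mul_one _
  obtain ⟨hw1, hw2⟩ := abs_le.1 hw
  have h0 : 0 ≤ π * t⁻¹ ^ 3 := by positivity
  rw [abs_le]
  constructor <;> linarith

theorem rpow_mul_rpow_eventuallyEq {a b r : ℝ} (h : a + b = r) :
    (fun t : ℝ => t ^ a * t ^ b) =ᶠ[atTop] fun t : ℝ => t ^ r := by
  filter_upwards [eventually_gt_atTop 0] with t ht
  rw [← rpow_add ht, h]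

theorem R₀_sub_R₁_leading :
    (fun t : ℝ => R₀ t - R₁ (α t) - π / 3 * t ^ (-2 : ℝ))
      =O[atTop] fun t : ℝ => t ^ (-(5 / 2) : ℝ) := by
  have h := fun {a : ℝ} (ha : a ≤ -(5 / 2)) (k : ℝ) => (isBigO_rpow_rpow ha).const_mul_left k
  refine ((((R₀_sub_R₁_expansion.trans (isBigO_rpow_rpow (by norm_num))).add
    (h le_rfl (1 / (2 * √2) * π ^ (1 / 2 : ℝ)))).sub
    (h (a := -3) (by norm_num) (11 / 15 * π ^ 2))).sub
    (h (a := -(7 / 2)) (by norm_num) (11 / (6 * √2) * π ^ (3 / 2 : ℝ)))).add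
    (h (a := -4) (by norm_num) ((103 / 70 * π ^ 2 - 5 / 8) * π)) |>.congr_left fun t => ?_
  rw [errorModel]; ring

theorem lineDist_expansion :
    (fun t : ℝ => lineDist (F₁ (α t)) (F₁ (α t) + deriv F₁ (α t)) (F₀ t) -
      (errorModel t + (103 / 70 * π ^ 2 - 2 / 3) * π * t ^ (-4 : ℝ)))
      =O[atTop] fun t : ℝ => t ^ (-(9 / 2) : ℝ) := by
  have hD2 : (fun t : ℝ => R₀ t - R₁ (α t)) =O[atTop] fun t : ℝ => t ^ (-2 : ℝ) :=
    ((R₀_sub_R₁_leading.trans (isBigO_rpow_rpow (by norm_num))).add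
      ((isBigO_refl (fun t : ℝ => t ^ (-2 : ℝ)) atTop).const_mul_left (π / 3))).congr_left
      fun t => by ring
  have h1 := ((hD2.mul invSpeed_α_expansion).congr' EventuallyEq.rfl
    (rpow_mul_rpow_eventuallyEq (r := -5) (by norm_num))).trans
    (isBigO_rpow_rpow (b := -(9 / 2)) (by norm_num))
  have h2 := ((R₀_sub_R₁_leading.mul
    ((isBigO_refl (fun t : ℝ => t ^ (-2 : ℝ)) atTop).const_mul_left (1 / 8))).congr'
    EventuallyEq.rfl (rpow_mul_rpow_eventuallyEq (r := -(9 / 2)) (by norm_num)))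
  refine ((R₀_sub_R₁_expansion.add h1).sub h2).congr' ?_ EventuallyEq.rfl
  filter_upwards [eventually_gt_atTop 0] with t ht
  have e : t ^ (-4 : ℝ) = t ^ (-2 : ℝ) * t ^ (-2 : ℝ) := by rw [← rpow_add ht]; norm_num
  rw [lineDist_eq ht, e]
  ring

theorem Asymptotics.IsBigO.of_sub_of_le_of_le {f g m e k : ℝ → ℝ} {l : Filter ℝ}
    (hf : (fun t => f t - m t) =O[l] k) (hg : (fun t => g t - m t) =O[l] k)
    (hfe : ∀ᶠ t in l, f t ≤ e t) (heg : ∀ᶠ t in l, e t ≤ g t) :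
    (fun t => e t - m t) =O[l] k := by
  refine IsBigO.trans (IsBigO.of_bound 1 ?_) (hf.norm_left.add hg.norm_left)
  filter_upwards [hfe, heg] with t h1 h2
  rw [one_mul]
  simp only [Real.norm_eq_abs]
  rw [abs_of_nonneg (a := |f t - m t| + |g t - m t|) (by positivity), abs_le]
  constructor <;> linarith [neg_abs_le (f t - m t), abs_nonneg (f t - m t),
    le_abs_self (g t - m t), abs_nonneg (g t - m t)]

theorem E₁_expansion :
    (fun t : ℝ => E₁ t - errorModel t) =O[atTop] fun t : ℝ => t ^ (-4 : ℝ) := by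
  have h := fun k : ℝ => (isBigO_refl (fun t : ℝ => t ^ (-4 : ℝ)) atTop).const_mul_left k
  have h1 := (lineDist_expansion.trans (isBigO_rpow_rpow (by norm_num : -(9 / 2) ≤ (-4 : ℝ)))).add
    (h ((103 / 70 * π ^ 2 - 2 / 3) * π))
  have h2 := (R₀_sub_R₁_expansion.trans (isBigO_rpow_rpow (by norm_num : -(9 / 2) ≤ (-4 : ℝ)))).add
    (h ((103 / 70 * π ^ 2 - 5 / 8) * π))
  refine IsBigO.of_sub_of_le_of_le (g := fun t => R₀ t - R₁ (α t)) (h1.congr_left fun t => by ring)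
    (h2.congr_left fun t => by ring) ?_ ?_
  · filter_upwards [eventually_ge_atTop 64] with t ht using lineDist_le_E₁ ht
  · filter_upwards [eventually_gt_atTop 0] with t ht using E₁_le ht

/-- Both coefficients of `t ^ (-4)` are linear in `π ^ 3` and `π`, so these bounds settle their
numerical values. -/
theorem pi_cube_bounds : 31.005 < π ^ 3 ∧ π ^ 3 < 31.0067 := by
  have h1 := pi_gt_d6
  have h2 := pi_lt_d6
  constructor
  · calc (31.005 : ℝ) < 3.141592 ^ 3 := by norm_num
      _ < π ^ 3 := by gcongr
  · calc π ^ 3 < 3.141593 ^ 3 := by gcongr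
      _ < 31.0067 := by norm_num

theorem theorem1 :
    -- (a) the upper bound and its expansion
    ((∀ t : ℝ, 2 * π ≤ t →
        E₁ t ≤ R₀ t - R₁ (α t) ∧ dist (F₀ t) (F₁ (α t)) = R₀ t - R₁ (α t)) ∧
      ((fun t : ℝ => R₀ t - R₁ (α t) -
          (errorModel t + (103 / 70 * π ^ 2 - 5 / 8) * π * t ^ (-4 : ℝ)))
        =O[atTop] fun t : ℝ => t ^ (-(9 / 2) : ℝ)) ∧
      |(103 / 70 * π ^ 2 - 5 / 8) * π - 43.66| < 0.005) ∧
    -- (b) the lower bound and its expansion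
    ((∀ᶠ t : ℝ in atTop,
        lineDist (F₁ (α t)) (F₁ (α t) + deriv F₁ (α t)) (F₀ t) ≤ E₁ t) ∧
      ((fun t : ℝ => lineDist (F₁ (α t)) (F₁ (α t) + deriv F₁ (α t)) (F₀ t) -
          (errorModel t + (103 / 70 * π ^ 2 - 2 / 3) * π * t ^ (-4 : ℝ)))
        =O[atTop] fun t : ℝ => t ^ (-(9 / 2) : ℝ)) ∧
      |(103 / 70 * π ^ 2 - 2 / 3) * π - 43.53| < 0.005) ∧
    -- (c) the expansion of the error
    ((fun t : ℝ => E₁ t -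
        (π / 3 * t ^ (-2 : ℝ) + 1 / (2 * √2) * π ^ (1 / 2 : ℝ) * t ^ (-(5 / 2) : ℝ)
          - 11 / 15 * π ^ 2 * t ^ (-3 : ℝ)
          - 11 / (6 * √2) * π ^ (3 / 2 : ℝ) * t ^ (-(7 / 2) : ℝ)))
      =O[atTop] fun t : ℝ => t ^ (-4 : ℝ)) := by
  obtain ⟨h3, h3'⟩ := pi_cube_bounds
  have hπ := pi_gt_d6
  have hπ' := pi_lt_d6
  refine ⟨⟨fun t ht => ?_, R₀_sub_R₁_expansion, ?_⟩, ⟨?_, lineDist_expansion, ?_⟩, E₁_expansion⟩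
  · have ht0 : 0 < t := two_pi_pos.trans_le ht
    exact ⟨E₁_le ht0, dist_F₀_F₁_α ht0⟩
  · rw [abs_lt]; constructor <;> linarith
  · filter_upwards [eventually_ge_atTop 64] with t ht using lineDist_le_E₁ ht
  · rw [abs_lt]; constructor <;> linarith
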